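/- Let $A$ be a unital uniform algebra, that is, a norm-closed subalgebra of $C(K)$ ($K$ compact Hausdorff, complex-valued functions, sup norm) which contains the constants and separates the points of $K$. Let $\mathfrak{M}_A$ be its maximal ideal space, with elements of $A$ identified with their Gelfand transforms, and let $\partial A\subseteq\mathfrak{M}_A$ be its Shilov boundary. Let $U=T_\varphi$ be a unital isometric endomorphism of $A$, let $\varphi:\mathfrak{M}_A\to\mathfrak{M}_A$, $\varphi(t)=t\circ U$, be the corresponding continuous map, let $w\in A$, and let $T=wT_\varphi$, i.e. $Tf=w\cdot Uf$ for $f\in A$. For $n\in\mathbb{N}=\{1,2,\dots\}$ put $w_n=w\,(w\circ\varphi)\cdots(w\circ\varphi^{n-1})$. Assume that $\varphi$ maps $\partial A$ into itself, that the map $\varphi:\partial A\to\partial A$ is open, that $\partial A$ has no isolated points, and that the set of $\varphi$-periodic points of $\partial A$ is of first category in $\partial A$. Assume also that there are $\lambda\in\mathbb{C}$ and points $t_n\in\partial A$, $n\in\mathbb{Z}$, such that $\varphi(t_n)=t_{n+1}$ for all $n\in\mathbb{Z}$ and \[ |w_n(t_0)|\le|\lambda|^n \quad\text{and}\quad |w_n(t_{-n})|\ge|\lambda|^n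 \qquad (n\in\mathbb{N}). \] Then $\lambda\in\sigma_{lsf}(T)$, the lower semi-Fredholm spectrum of $T$ on $A$; that is, the operator $\lambda I-T$ is not lower semi-Fredholm, where a bounded operator is called lower semi-Fredholm if its range is closed and has finite codimension. -/

import Mathlib

open WeakDual Topology Set

/-- A unital uniform algebra on the compact Hausdorff space `K`: a norm-closed subalgebra of
`C(K, ℂ)` that contains the constants (every `Subalgebra` does) and separates the points of `K`. -/
structure IsUniformAlgebra {K : Type*} [TopologicalSpace K] [CompactSpace K]
    (A : Subalgebra ℂ C(K, ℂ)) : Prop where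
  isClosed : IsClosed (A : Set C(K, ℂ))
  separatesPoints : A.SeparatesPoints

section Gelfand

variable {B : Type*} [NormedCommRing B] [NormedAlgebra ℂ B]

/-- A closed boundary of `B`: a closed set `E` of characters such that the modulus of the Gelfand
transform of every element of `B` attains its maximum over the whole maximal ideal space
at some point of `E`. -/
def IsClosedBoundary (E : Set (characterSpace ℂ B)) : Prop :=
  IsClosed E ∧ ∀ f : B, ∃ t ∈ E, ∀ s : characterSpace ℂ B, ‖s f‖ ≤ ‖t f‖

variable (B) in
/-- The Shilov boundary of `B`, inside the maximal ideal space: the intersection of all closed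
boundaries. -/
def shilovBoundary : Set (characterSpace ℂ B) :=
  ⋂₀ {E | IsClosedBoundary E}

/-- The self-map `φ` of the maximal ideal space induced by a unital endomorphism `U` of `B`:
`φ t = t ∘ U`. -/
noncomputable def spectrumMap (U : B →A[ℂ] B) (t : characterSpace ℂ B) : characterSpace ℂ B :=
  ⟨(CharacterSpace.toCLM t).comp U.toContinuousLinearMap, by
    rw [CharacterSpace.eq_set_map_one_map_mul]
    refine ⟨?_, fun x y => ?_⟩
    · change t (U 1) = 1
      rw [map_one, map_one]
    · change t (U (x * y)) = t (U x) * t (U y)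
      rw [map_mul, map_mul]⟩

/-- The defining property of the induced map: `f (φ t) = (U f) t` for Gelfand transforms. -/
theorem spectrumMap_apply (U : B →A[ℂ] B) (t : characterSpace ℂ B) (f : B) :
    spectrumMap U t f = t (U f) := rfl

/-- The cocycle `w_n = w · (w ∘ φ) ⋯ (w ∘ φ^{n-1})` on the maximal ideal space, where `w` is
identified with its Gelfand transform and `φ` is the map induced by `U`. -/
noncomputable def weightCocycle (w : B) (U : B →A[ℂ] B) (n : ℕ) (t : characterSpace ℂ B) : ℂ :=
  ∏ i ∈ Finset.range n, ((spectrumMap U)^[i] t) w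

/-- The weighted endomorphism `T = w U`, that is `T f = w * U f`. -/
noncomputable def weightedEndomorphism (w : B) (U : B →A[ℂ] B) : B →L[ℂ] B :=
  (ContinuousLinearMap.mul ℂ B w).comp U.toContinuousLinearMap

theorem weightedEndomorphism_apply (w : B) (U : B →A[ℂ] B) (f : B) :
    weightedEndomorphism w U f = w * U f := rfl

end Gelfand

section SemiFredholm

variable {X : Type*} [NormedAddCommGroup X] [NormedSpace ℂ X]

/-- A bounded operator is lower semi-Fredholm if its range is closed and of finite codimension. -/
def IsLowerSemiFredholm (S : X →L[ℂ] X) : Prop :=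
  IsClosed (range S) ∧
    FiniteDimensional ℂ (X ⧸ LinearMap.range (S : X →ₗ[ℂ] X))

/-- The lower semi-Fredholm spectrum: all `z` such that `z I - T` is not lower semi-Fredholm. -/
def lowerSemiFredholmSpectrum (T : X →L[ℂ] X) : Set ℂ :=
  {z | ¬ IsLowerSemiFredholm (z • ContinuousLinearMap.id ℂ X - T)}

end SemiFredholm

/-! ### Existence of the Shilov boundary, and elements peaking on its relatively open subsets. -/

section Boundary

variable {B : Type*} [NormedCommRing B] [NormedAlgebra ℂ B]

/-! The adjoint of `T` sends the point evaluation `δ_t` to `w(t) δ_{φ(t)}`. On the given orbit the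
two growth conditions say exactly that the formal eigenvector `∑ a_n δ_{t_n}` of the adjoint has
`‖a_n‖ ≤ 1 = ‖a_0‖` (for `z ≠ 0`). A triangular cut-off turns it into finitely supported
coefficients `α` for which `(z - T)*` has defect at most `ε` times `L = ∑ ‖α_i‖`
(`exists_orbit_almost_null_coefficients`).

With `α` fixed, smallness of the defect is an open condition on the starting point of the orbit
segment. Hence it persists at `k` nearby points, which can be chosen with all their orbit segments
injective and pairwise disjoint (`exists_seq_injective_iterate`), even if the original orbit is
periodic. Peaking elements at these points (`exists_orbits_forall_peak`) then show that each of the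
`k` functionals has norm comparable to `L`.

If `z - T` had closed range of codimension `k - 1`, a normalized combination `h` of `k` such test
elements would lie in the range, with a preimage `g` of norm at most `2C`. One of the functionals is
at least `L/2` on `h`, whereas summation by parts bounds it by `ε L ‖g‖ ≤ L/4`. -/

theorem continuous_character_apply (f : B) :
    Continuous fun t : characterSpace ℂ B => t f :=
  (WeakDual.eval_continuous f).comp continuous_subtype_val

/-- Some `f` has its maximum modulus strictly above its values on `E \ V`. By compactness the gap is
uniform there, so a high power of `f`, normalized at a maximum point, is below `δ` off `V`. -/
theorem exists_apply_eq_one_of_not_isClosedBoundary_diff [CompleteSpace B]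
    {E V : Set (characterSpace ℂ B)} (hE : IsClosedBoundary E) (hV : IsOpen V)
    (hEV : ¬ IsClosedBoundary (E \ V)) {δ : ℝ} (hδ : 0 < δ) :
    ∃ f : B, ∃ u ∈ E ∩ V, u f = 1 ∧ (∀ s : characterSpace ℂ B, ‖s f‖ ≤ 1) ∧
      ∀ t ∈ E \ V, ‖t f‖ < δ := by
  have hcl : IsClosed (E \ V) := hE.1.sdiff hV
  rcases (E \ V).eq_empty_or_nonempty with h0 | hne
  · obtain ⟨u, hu, -⟩ := hE.2 1
    have huV : u ∈ V := by
      by_contra h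
      exact (h0 ▸ (⟨hu, h⟩ : u ∈ E \ V) : u ∈ (∅ : Set _))
    refine ⟨1, u, ⟨hu, huV⟩, map_one u, fun s => by simp, ?_⟩
    simp [h0]
  · have h : ∃ f : B, ∀ t ∈ E \ V, ∃ s : characterSpace ℂ B, ‖t f‖ < ‖s f‖ := by
      by_contra! h
      exact hEV ⟨hcl, h⟩
    obtain ⟨f, hf⟩ := h
    obtain ⟨u, hu, humax⟩ := hE.2 f
    have hlt : ∀ t ∈ E \ V, ‖t f‖ < ‖u f‖ := fun t ht => by
      obtain ⟨s, hs⟩ := hf t ht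
      exact hs.trans_le (humax s)
    have huV : u ∈ V := by
      by_contra h
      exact lt_irrefl _ (hlt u ⟨hu, h⟩)
    obtain ⟨t₀, ht₀, hmax⟩ := hcl.isCompact.exists_isMaxOn hne
      (continuous_character_apply f).norm.continuousOn
    have hpos : 0 < ‖u f‖ := (norm_nonneg _).trans_lt (hlt t₀ ht₀)
    have hr : ‖t₀ f‖ / ‖u f‖ < 1 := (div_lt_one hpos).2 (hlt t₀ ht₀)
    obtain ⟨n, hn⟩ := exists_pow_lt_of_lt_one hδ hr
    have hval : ∀ s : characterSpace ℂ B,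
        ‖s (((u f)⁻¹ • f) ^ n)‖ = (‖s f‖ / ‖u f‖) ^ n := fun s => by
      rw [map_pow, map_smul, norm_pow, smul_eq_mul, norm_mul, norm_inv]
      congr 1
      ring
    refine ⟨((u f)⁻¹ • f) ^ n, u, ⟨hu, huV⟩, ?_, fun s => ?_, fun t ht => ?_⟩
    · rw [map_pow, map_smul, smul_eq_mul, inv_mul_cancel₀ (norm_pos_iff.1 hpos), one_pow]
    · rw [hval]
      exact pow_le_one₀ (by positivity) ((div_le_one hpos).2 (humax s))
    · rw [hval]
      refine lt_of_le_of_lt ?_ hn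
      have : ‖t f‖ ≤ ‖t₀ f‖ := hmax ht
      gcongr

/-- Zorn's lemma: for each `f`, the members of a chain meet the compact set of maximum points of `f`
in nested nonempty compact sets, so their intersection still meets it. -/
theorem exists_minimal_isClosedBoundary [CompleteSpace B] [Nonempty (characterSpace ℂ B)] :
    ∃ E : Set (characterSpace ℂ B), Minimal IsClosedBoundary E := by
  refine zorn_superset {E : Set (characterSpace ℂ B) | IsClosedBoundary E} fun c hc hchain => ?_
  have hmaxclosed : ∀ f : B, IsClosed {t : characterSpace ℂ B |
      ∀ s : characterSpace ℂ B, ‖s f‖ ≤ ‖t f‖} := fun f => by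
    simp only [ofPred_forall]
    exact isClosed_iInter fun s =>
      isClosed_le continuous_const (continuous_character_apply f).norm
  rcases c.eq_empty_or_nonempty with rfl | hne
  · refine ⟨univ, ⟨isClosed_univ, fun f => ?_⟩, by simp⟩
    obtain ⟨t, -, ht⟩ := isCompact_univ.exists_isMaxOn univ_nonempty
      (continuous_character_apply f).norm.continuousOn
    exact ⟨t, mem_univ _, fun s => ht (mem_univ s)⟩
  · refine ⟨⋂₀ c, ⟨isClosed_sInter fun E hE => (hc hE).1, fun f => ?_⟩,
      fun s hs => sInter_subset_of_mem hs⟩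
    have hcne : Nonempty c := hne.to_subtype
    have : (⋂ E : c, (E : Set (characterSpace ℂ B)) ∩ {t : characterSpace ℂ B |
        ∀ s : characterSpace ℂ B, ‖s f‖ ≤ ‖t f‖}).Nonempty := by
      apply IsCompact.nonempty_iInter_of_directed_nonempty_isCompact_isClosed
      · intro E F
        rcases hchain.total E.2 F.2 with h | h
        · exact ⟨E, subset_rfl, inter_subset_inter_left _ h⟩
        · exact ⟨F, inter_subset_inter_left _ h, subset_rfl⟩
      · intro E
        obtain ⟨t, ht, ht'⟩ := (hc E.2).2 f
        exact ⟨t, ht, ht'⟩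
      · exact fun E => ((hc E.2).1.inter (hmaxclosed f)).isCompact
      · exact fun E => (hc E.2).1.inter (hmaxclosed f)
    obtain ⟨t, ht⟩ := this
    rw [mem_iInter] at ht
    exact ⟨t, fun E hE => (ht ⟨E, hE⟩).1, (ht (Classical.arbitrary c)).2⟩

theorem not_isClosedBoundary_diff_of_minimal {E V : Set (characterSpace ℂ B)}
    (hE : Minimal IsClosedBoundary E) (hEV : (E ∩ V).Nonempty) :
    ¬ IsClosedBoundary (E \ V) := fun h => by
  obtain ⟨x, hx, hxV⟩ := hEV
  exact (hE.2 h sdiff_subset hx).2 hxV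

/-- Suppose `x ∈ E \ F`. Finitely many `p y` vanish at `x` while at each point of `F` one of them
exceeds 1 in modulus. An `f` of maximum modulus 1, tiny on `E` away from the neighbourhood `V` of
`x` where all these `p y` are below 1, makes every `f * p y` smaller than 1 everywhere. This fails
at a point of `F` where `‖f‖` attains 1. -/
theorem Minimal.subset_of_isClosedBoundary [CompleteSpace B] {E F : Set (characterSpace ℂ B)}
    (hE : Minimal IsClosedBoundary E) (hF : IsClosedBoundary F) : E ⊆ F := by
  intro x hx
  by_contra hxF
  have hsep : ∀ y ∈ F, ∃ f : B, x f = 0 ∧ 1 < ‖y f‖ := fun y hy => by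
    have hxy : y ≠ x := fun h => hxF (h ▸ hy)
    obtain ⟨f, hf⟩ := DFunLike.ne_iff.1 hxy
    have hf' : y f - x f ≠ 0 := sub_ne_zero.2 hf
    refine ⟨(2 * (y f - x f)⁻¹) • (f - algebraMap ℂ B (x f)), ?_, ?_⟩
    · simp [AlgHomClass.commutes]
    · have : y ((2 * (y f - x f)⁻¹) • (f - algebraMap ℂ B (x f))) = 2 := by
        rw [map_smul, map_sub, AlgHomClass.commutes]
        simp [hf']
      rw [this]
      norm_num
  choose! p hp0 hp1 using hsep
  obtain ⟨s, hs⟩ := hF.1.isCompact.elim_nhds_subcover' (fun y _ => {q | 1 < ‖q (p y)‖})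
    fun y hy => (isOpen_lt continuous_const (continuous_character_apply (p y)).norm).mem_nhds
      (hp1 y hy)

  set V : Set (characterSpace ℂ B) := ⋂ y ∈ s, {q | ‖q (p (y : characterSpace ℂ B))‖ < 1} with hVdef
  have hV : IsOpen V := isOpen_biInter_finset fun y _ =>
    isOpen_lt (continuous_character_apply _).norm continuous_const
  have hxV : x ∈ V := by
    simp only [hVdef, mem_iInter]
    intro y _
    simp [hp0 y y.2]
  -- The factor `‖1‖` is the available bound for the norm of a character, as `‖1‖ = 1` is not
  -- assumed.
  obtain ⟨M, hM⟩ : ∃ M : ℝ, ∀ y ∈ s, ‖p (y : characterSpace ℂ B)‖ * ‖(1 : B)‖ ≤ M := by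
    obtain ⟨M, hM⟩ := (s.image fun y : F => ‖p (y : characterSpace ℂ B)‖ * ‖(1 : B)‖).bddAbove
    exact ⟨M, fun y hy => hM (Finset.mem_coe.2 (Finset.mem_image_of_mem _ hy))⟩
  obtain ⟨f, u, ⟨huE, huV⟩, huf, hf1, hfδ⟩ := exists_apply_eq_one_of_not_isClosedBoundary_diff
    hE.1 hV (not_isClosedBoundary_diff_of_minimal hE ⟨x, hx, hxV⟩)
    (δ := 1 / (|M| + 1)) (by positivity)
  have hprod : ∀ y ∈ s, ∀ q : characterSpace ℂ B, ‖q (f * p (y : characterSpace ℂ B))‖ < 1 := by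
    intro y hy q
    obtain ⟨e, heE, he⟩ := hE.1.2 (f * p y)
    refine (he q).trans_lt ?_
    rw [map_mul, norm_mul]
    by_cases heV : e ∈ V
    · have h1 : ‖e (p y)‖ < 1 := by
        simp only [hVdef, mem_iInter] at heV
        exact heV y hy
      nlinarith [hf1 e, norm_nonneg (e f), norm_nonneg (e (p y))]
    · have h1 := hfδ e ⟨heE, heV⟩
      have h2 : ‖e (p y)‖ ≤ |M| := by
        refine ((CharacterSpace.toCLM e).le_opNorm (p y)).trans ?_
        refine le_trans ?_ ((hM y hy).trans (le_abs_self M))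
        rw [mul_comm]
        gcongr
        exact CharacterSpace.norm_le_norm_one e
      rw [lt_div_iff₀ (by positivity)] at h1
      nlinarith [norm_nonneg (e f), norm_nonneg (e (p y))]
  obtain ⟨v, hvF, hv⟩ := hF.2 f
  have hv1 : ‖v f‖ = 1 := le_antisymm (hf1 v) (by simpa [huf] using hv u)
  obtain ⟨y, hys, hy⟩ := mem_iUnion₂.1 (hs hvF)
  have := hprod y hys v
  rw [map_mul, norm_mul, hv1, one_mul] at this
  exact lt_asymm this hy

variable (B) in
theorem minimal_isClosedBoundary_shilovBoundary [CompleteSpace B]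
    [Nonempty (characterSpace ℂ B)] : Minimal IsClosedBoundary (shilovBoundary B) := by
  obtain ⟨E, hE⟩ := exists_minimal_isClosedBoundary (B := B)
  have : shilovBoundary B = E := subset_antisymm (sInter_subset_of_mem hE.1)
    (subset_sInter fun F hF => hE.subset_of_isClosedBoundary hF)
  rwa [this]

/-- Relatively open pieces of the Shilov boundary carry peaking elements. -/
theorem exists_apply_eq_one_of_isOpen_shilovBoundary [CompleteSpace B]
    [Nonempty (characterSpace ℂ B)] {V : Set (shilovBoundary B)} (hV : IsOpen V)
    (hne : V.Nonempty) {δ : ℝ} (hδ : 0 < δ) :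
    ∃ f : B, ∃ u ∈ V, (u : characterSpace ℂ B) f = 1 ∧
      (∀ s : characterSpace ℂ B, ‖s f‖ ≤ 1) ∧
      ∀ t : shilovBoundary B, t ∉ V → ‖(t : characterSpace ℂ B) f‖ < δ := by
  obtain ⟨G, hG, rfl⟩ := isOpen_induced_iff.1 hV
  obtain ⟨x, hx⟩ := hne
  have hmin := minimal_isClosedBoundary_shilovBoundary B
  obtain ⟨f, u, ⟨huE, huG⟩, h1, h2, h3⟩ := exists_apply_eq_one_of_not_isClosedBoundary_diff
    hmin.1 hG (not_isClosedBoundary_diff_of_minimal hmin ⟨x, x.2, hx⟩) hδ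
  exact ⟨f, ⟨u, huE⟩, huG, h1, h2, fun t ht => h3 t ⟨t.2, ht⟩⟩

end Boundary

/-! ### Disjoint orbit segments of an open map of a perfect Baire space. -/

section Orbits

variable {Y : Type*} [TopologicalSpace Y]

theorem isOpenMap_iterate {Φ : Y → Y} (h : IsOpenMap Φ) : ∀ n : ℕ, IsOpenMap Φ^[n]
  | 0 => IsOpenMap.id
  | n + 1 => (isOpenMap_iterate h n).comp h

/-- Iterates of an open map send nonempty open sets to nonempty open sets, which meet the complement
of a finite set and, by Baire, that of the periodic points. The open set is shrunk once for each
time. -/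
theorem exists_mem_iterate_notMem_of_finite [T1Space Y] [BaireSpace Y] {Φ : Y → Y}
    (hcont : Continuous Φ) (hopen : IsOpenMap Φ) (hperf : ∀ x : Y, ¬ IsOpen ({x} : Set Y))
    (hper : IsMeagre (Function.periodicPts Φ)) {V : Set Y} (hV : IsOpen V) (hne : V.Nonempty)
    {P : Set Y} (hP : P.Finite) (m : ℕ) :
    ∃ s ∈ V, (∀ i < m, Φ^[i] s ∉ P) ∧ Φ^[m] s ∉ Function.periodicPts Φ := by
  have hdense : Dense Pᶜ := by
    have (x : Y) : (𝓝[≠] x).NeBot := by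
      rw [Filter.neBot_iff, Ne, ← isOpen_singleton_iff_punctured_nhds]
      exact hperf x
    simpa [compl_eq_univ_sdiff] using dense_univ.sdiff_finite hP
  have key : ∀ n : ℕ, ∃ V' ⊆ V, IsOpen V' ∧ V'.Nonempty ∧ ∀ s ∈ V', ∀ i < n, Φ^[i] s ∉ P := by
    intro n
    induction n with
    | zero => exact ⟨V, subset_rfl, hV, hne, by simp⟩
    | succ n ih =>
      obtain ⟨V', hsub, hV', hne', h⟩ := ih
      obtain ⟨_, ⟨s, hs, rfl⟩, hsP⟩ := hdense.inter_open_nonempty _ (isOpenMap_iterate hopen n V' hV')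
        (hne'.image _)
      refine ⟨V' ∩ Φ^[n] ⁻¹' Pᶜ, inter_subset_left.trans hsub,
        hV'.inter (hP.isClosed.isOpen_compl.preimage (hcont.iterate n)), ⟨s, hs, hsP⟩, ?_⟩
      rintro q ⟨hq, hqP⟩ i hi
      rcases (Nat.lt_succ_iff_lt_or_eq.1 hi) with hi | rfl
      · exact h q hq i hi
      · exact hqP
  obtain ⟨V', hsub, hV', hne', h⟩ := key m
  obtain ⟨_, ⟨s, hs, rfl⟩, hsP⟩ := (dense_of_mem_residual hper).inter_open_nonempty _
    (isOpenMap_iterate hopen m V' hV') (hne'.image _)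
  exact ⟨s, hsub hs, h s hs, hsP⟩

/-- Points are chosen inductively so as to avoid the earlier segments. Within one segment, a
coincidence `Φ^[i] q = Φ^[i'] q` would make `Φ^[m] q` periodic. Non-periodicity of `q` itself would
not suffice, since `q` could be preperiodic. -/
theorem exists_seq_injective_iterate [T1Space Y] [BaireSpace Y] {Φ : Y → Y}
    (hcont : Continuous Φ) (hopen : IsOpenMap Φ) (hperf : ∀ x : Y, ¬ IsOpen ({x} : Set Y))
    (hper : IsMeagre (Function.periodicPts Φ)) {V : Set Y} (hV : IsOpen V) (hne : V.Nonempty)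
    (m : ℕ) :
    ∃ s : ℕ → Y, (∀ j, s j ∈ V) ∧
      Function.Injective fun p : ℕ × Fin m => Φ^[p.2] (s p.1) := by
  obtain ⟨s, hs, hr⟩ := exists_seq_of_forall_finset_exists
    (fun q => q ∈ V ∧ Φ^[m] q ∉ Function.periodicPts Φ)
    (fun q q' => ∀ i < m, ∀ i' < m, Φ^[i] q ≠ Φ^[i'] q') fun S _ => by
      have hfin : (⋃ q ∈ S, (fun i => Φ^[i] q) '' Iio m).Finite :=
        S.finite_toSet.biUnion fun q _ => (finite_Iio m).image _
      obtain ⟨q', hq', h1, h2⟩ := exists_mem_iterate_notMem_of_finite hcont hopen hperf hper hV hne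
        hfin m
      refine ⟨q', ⟨hq', h2⟩, fun q hq i hi i' hi' h => h1 i' hi' ?_⟩
      exact mem_iUnion₂.2 ⟨q, hq, i, hi, h⟩
  refine ⟨s, fun j => (hs j).1, ?_⟩
  have hself : ∀ q : Y, Φ^[m] q ∉ Function.periodicPts Φ → ∀ i i' : ℕ, i < i' → i' < m →
      Φ^[i] q ≠ Φ^[i'] q := by
    intro q hq i i' hii hi' h
    refine hq (Function.mk_mem_periodicPts (n := i' - i) (by omega) ?_)
    have := congrArg (Φ^[m - i]) h
    rw [← Function.iterate_add_apply, ← Function.iterate_add_apply] at this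
    rw [Function.IsPeriodicPt, Function.IsFixedPt, ← Function.iterate_add_apply,
      show i' - i + m = m - i + i' by omega, ← this, show m - i + i = m by omega]
  rintro ⟨j, i⟩ ⟨j', i'⟩ h
  dsimp only at h
  rcases lt_trichotomy j j' with hj | rfl | hj
  · exact absurd h (hr j j' hj i i.2 i' i'.2)
  · rcases lt_trichotomy (i : ℕ) i' with hi | hi | hi
    · exact absurd h (hself _ (hs j).2 i i' hi i'.2)
    · rw [Fin.ext hi]
    · exact absurd h.symm (hself _ (hs j).2 i' i hi i.2)
  · exact absurd h.symm (hr j' j hj i' i'.2 i i.2)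

end Orbits

/-! ### Simultaneous peaking elements along orbit segments. -/

section Peaks

variable {B : Type*} [NormedCommRing B] [NormedAlgebra ℂ B] [CompleteSpace B]
  [Nonempty (characterSpace ℂ B)]

/-- The location of a peak inside an open set cannot be prescribed. So for each index in turn a peak
is found in the open image `ψ i V'`, and `V'` is shrunk to the points whose image under `ψ i` is
near it. -/
theorem exists_open_forall_peak {ι : Type*} {ψ : ι → shilovBoundary B → shilovBoundary B}
    (hcont : ∀ i, Continuous (ψ i)) (hopen : ∀ i, IsOpenMap (ψ i))
    {V : Set (shilovBoundary B)} (hV : IsOpen V) (hne : V.Nonempty)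
    {W : ι → Set (shilovBoundary B)} (hW : ∀ i, MapsTo (ψ i) V (W i))
    {δ : ℝ} (hδ : 0 < δ) (I : Finset ι) :
    ∃ f : ι → B, ∃ V' ⊆ V, IsOpen V' ∧ V'.Nonempty ∧
      ∀ i ∈ I, (∀ s : characterSpace ℂ B, ‖s (f i)‖ ≤ 1) ∧
        (∀ q : shilovBoundary B, q ∉ W i → ‖(q : characterSpace ℂ B) (f i)‖ < δ) ∧
        ∀ q ∈ V', ‖(ψ i q : characterSpace ℂ B) (f i) - 1‖ < δ := by
  classical
  induction I using Finset.induction_on with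
  | empty => exact ⟨fun _ => 0, V, subset_rfl, hV, hne, by simp⟩
  | insert i I hi ih =>
    obtain ⟨f, V', hsub, hV', hne', h⟩ := ih
    obtain ⟨g, _, ⟨v, hv, rfl⟩, hg1, hg2, hg3⟩ :=
      exists_apply_eq_one_of_isOpen_shilovBoundary (hopen i V' hV') (hne'.image _) hδ
    refine ⟨Function.update f i g,
      V' ∩ {q | ‖(ψ i q : characterSpace ℂ B) g - 1‖ < δ}, inter_subset_left.trans hsub,
      hV'.inter (isOpen_lt ((((continuous_character_apply g).comp
        (continuous_subtype_val.comp (hcont i))).sub continuous_const).norm) continuous_const),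
      ⟨v, hv, by simpa [hg1] using hδ⟩, fun j hj => ?_⟩
    by_cases hji : j = i
    · subst hji
      rw [Function.update_self]
      refine ⟨hg2, fun q hq => hg3 q fun hq' => hq ?_, fun q hq => hq.2⟩
      exact (hW j).image_subset (image_mono hsub hq')
    · rw [Function.update_of_ne hji]
      obtain ⟨h1, h2, h3⟩ := h j ((Finset.mem_insert.1 hj).resolve_left hji)
      exact ⟨h1, h2, fun q hq => h3 q hq.1⟩

/-- Finitely many orbit segments starting in a given open set, with elements that peak, up to `δ`,
at the points of these segments and are small away from pairwise disjoint sets. -/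
theorem exists_orbits_forall_peak {Φ : shilovBoundary B → shilovBoundary B}
    (hcont : Continuous Φ) (hopen : IsOpenMap Φ)
    (hperf : ∀ x : shilovBoundary B, ¬ IsOpen ({x} : Set (shilovBoundary B)))
    (hper : IsMeagre (Function.periodicPts Φ)) {V : Set (shilovBoundary B)} (hV : IsOpen V)
    (hne : V.Nonempty) (k m : ℕ) {δ : ℝ} (hδ : 0 < δ) :
    ∃ (s : Fin k → shilovBoundary B) (f : Fin k → Fin m → B)
      (W : Fin k × Fin m → Set (shilovBoundary B)),
      (∀ j, s j ∈ V) ∧ Pairwise (Function.onFun Disjoint W) ∧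
      (∀ j (i : Fin m), Φ^[i] (s j) ∈ W (j, i)) ∧
      (∀ j i, ∀ q : characterSpace ℂ B, ‖q (f j i)‖ ≤ 1) ∧
      (∀ j i, ∀ q : shilovBoundary B, q ∉ W (j, i) → ‖(q : characterSpace ℂ B) (f j i)‖ < δ) ∧
      ∀ j (i : Fin m), ‖(Φ^[i] (s j) : characterSpace ℂ B) (f j i) - 1‖ < δ := by
  have hcl : IsClosed (shilovBoundary B) := (minimal_isClosedBoundary_shilovBoundary B).1.1
  have : CompactSpace (shilovBoundary B) := isCompact_iff_compactSpace.1 hcl.isCompact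
  obtain ⟨s, hsV, hinj⟩ := exists_seq_injective_iterate hcont hopen hperf hper hV hne m
  have hinj' : Function.Injective fun p : Fin k × Fin m => Φ^[p.2] (s p.1) := by
    rintro ⟨j, i⟩ ⟨j', i'⟩ h
    have := @hinj (j, i) (j', i') h
    simp only [Prod.mk.injEq] at this ⊢
    exact ⟨Fin.ext this.1, this.2⟩
  obtain ⟨G, hG, hdisj⟩ := (finite_range fun p : Fin k × Fin m => Φ^[p.2] (s p.1)).t2_separation
  let W : Fin k × Fin m → Set (shilovBoundary B) := fun p => G (Φ^[p.2] (s p.1))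
  have hW : Pairwise (Function.onFun Disjoint W) := fun p p' hp =>
    hdisj ⟨p, rfl⟩ ⟨p', rfl⟩ fun h => hp (hinj' h)
  have hpeak : ∀ j : Fin k, ∃ f : Fin m → B, ∃ V' ⊆ V ∩ ⋂ i : Fin m, Φ^[i] ⁻¹' W (j, i),
      IsOpen V' ∧ V'.Nonempty ∧ ∀ i ∈ (Finset.univ : Finset (Fin m)),
        (∀ s : characterSpace ℂ B, ‖s (f i)‖ ≤ 1) ∧
        (∀ q : shilovBoundary B, q ∉ W (j, i) → ‖(q : characterSpace ℂ B) (f i)‖ < δ) ∧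
        ∀ q ∈ V', ‖(Φ^[i] q : characterSpace ℂ B) (f i) - 1‖ < δ := fun j => by
    refine exists_open_forall_peak (ψ := fun i : Fin m => Φ^[i])
      (V := V ∩ ⋂ i : Fin m, Φ^[i] ⁻¹' W (j, i)) (fun i => hcont.iterate i)
      (fun i => isOpenMap_iterate hopen i) ?_ ⟨s j, hsV j, mem_iInter.2 fun i => (hG _).1⟩ ?_ hδ _
    · exact hV.inter (isOpen_iInter_of_finite fun i => (hG _).2.preimage (hcont.iterate i))
    · exact fun i q hq => mem_iInter.1 hq.2 i
  choose f V' hsub hV' hne' h using hpeak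
  choose r hr using hne'
  exact ⟨r, f, W, fun j => (hsub j (hr j)).1, hW, fun j i => mem_iInter.1 (hsub j (hr j)).2 i,
    fun j i => (h j i (Finset.mem_univ _)).1, fun j i => (h j i (Finset.mem_univ _)).2.1,
    fun j i => (h j i (Finset.mem_univ _)).2.2 _ (hr j)⟩

end Peaks

/-! ### Triangular cut-off of a bounded solution of the eigenvector recurrence. -/

section Taper

theorem sum_range_eq_sum_Icc_neg (h : ℤ → ℝ) (N : ℕ) :
    ∑ i ∈ Finset.range (2 * N + 1), h ((i : ℤ) - N) = ∑ n ∈ Finset.Icc (-(N : ℤ)) N, h n := by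
  refine Finset.sum_nbij' (fun i => (i : ℤ) - N) (fun n => (n + N).toNat) ?_ ?_ ?_ ?_ ?_ <;>
    simp only [Finset.mem_range, Finset.mem_Icc] <;> intros <;> first | omega | trivial

/-- If some window sum exceeds `6 / c`, double the window: the left side is at most `(4N + 1) / (2N)
≤ 3`, and the taper is at least `1/2` on the inner half, so the right side exceeds 3. Otherwise all
window sums are at most `6 / c`, so the left side tends to 0, while the term `n = 0` keeps the right
side at least `c`. -/
theorem exists_sum_lt_mul_sum_taper {r : ℤ → ℝ} (h0 : ∀ n, 0 ≤ r n) (h1 : ∀ n, r n ≤ 1)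
    (hr : r 0 = 1) {c : ℝ} (hc : 0 < c) :
    ∃ N : ℕ, 0 < N ∧ (1 / N : ℝ) * ∑ n ∈ Finset.Icc (-(N : ℤ)) N, r n <
      c * ∑ n ∈ Finset.Icc (-(N : ℤ)) N, (1 - |(n : ℝ)| / N) * r n := by
  have hb : ∀ N : ℕ, 0 < N → ∀ n ∈ Finset.Icc (-(N : ℤ)) N, 0 ≤ 1 - |(n : ℝ)| / N := by
    intro N hN n hn
    rw [Finset.mem_Icc] at hn
    rw [sub_nonneg, div_le_one (by exact_mod_cast hN)]
    exact_mod_cast abs_le.2 hn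
  by_cases h : ∃ N : ℕ, 0 < N ∧ 6 / c < ∑ n ∈ Finset.Icc (-(N : ℤ)) N, r n
  · obtain ⟨N, hN, hlt⟩ := h
    have hN' : (1 : ℝ) ≤ N := by exact_mod_cast hN
    refine ⟨2 * N, by omega, ?_⟩
    have hle : ∑ n ∈ Finset.Icc (-((2 * N : ℕ) : ℤ)) (2 * N : ℕ), r n ≤ 4 * N + 1 := by
      refine (Finset.sum_le_card_nsmul _ _ 1 fun n _ => h1 n).trans ?_
      rw [Int.card_Icc, nsmul_eq_mul, mul_one]
      have : (((2 * N : ℕ) : ℤ) + 1 - -((2 * N : ℕ) : ℤ)).toNat = 4 * N + 1 := by omega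
      rw [this]
      push_cast
      rfl
    have hge : 1 / 2 * ∑ n ∈ Finset.Icc (-(N : ℤ)) N, r n ≤
        ∑ n ∈ Finset.Icc (-((2 * N : ℕ) : ℤ)) (2 * N : ℕ),
          (1 - |(n : ℝ)| / (2 * N : ℕ)) * r n := by
      rw [Finset.mul_sum]
      refine (Finset.sum_le_sum fun n hn => ?_).trans
        (Finset.sum_le_sum_of_subset_of_nonneg
          (Finset.Icc_subset_Icc (by push_cast; omega) (by push_cast; omega)) fun n hn _ =>
            mul_nonneg (hb (2 * N) (by omega) n hn) (h0 n))
      refine mul_le_mul_of_nonneg_right ?_ (h0 n)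
      rw [Finset.mem_Icc] at hn
      have h2 : |(n : ℝ)| ≤ N := by exact_mod_cast abs_le.2 hn
      have h3 : |(n : ℝ)| / (2 * N : ℕ) ≤ 1 / 2 := by
        rw [div_le_iff₀ (by push_cast; linarith)]
        push_cast
        linarith
      linarith
    have hl : (1 / (2 * N : ℕ) : ℝ) * ∑ n ∈ Finset.Icc (-((2 * N : ℕ) : ℤ)) (2 * N : ℕ), r n ≤
        3 := by
      rw [one_div, inv_mul_le_iff₀ (by push_cast; linarith)]
      push_cast at hle ⊢
      linarith
    have hu : 3 < c * (1 / 2 * ∑ n ∈ Finset.Icc (-(N : ℤ)) N, r n) := by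
      rw [div_lt_iff₀ hc] at hlt
      linarith
    exact hl.trans_lt (hu.trans_le (mul_le_mul_of_nonneg_left hge hc.le))
  · push Not at h
    obtain ⟨N, hN⟩ := exists_nat_gt (6 / c / c)
    have hN0 : (0 : ℝ) < N := lt_trans (by positivity) hN
    have hN1 : 0 < N := by exact_mod_cast hN0
    refine ⟨N, hN1, ?_⟩
    have hge : 1 ≤ ∑ n ∈ Finset.Icc (-(N : ℤ)) N, (1 - |(n : ℝ)| / N) * r n := by
      refine le_trans (by simp [hr]) (Finset.single_le_sum
        (fun n hn => mul_nonneg (hb N hN1 n hn) (h0 n))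
        (show (0 : ℤ) ∈ Finset.Icc (-(N : ℤ)) N by simp))
    have hlt : (1 / N : ℝ) * ∑ n ∈ Finset.Icc (-(N : ℤ)) N, r n < c := by
      rw [one_div, inv_mul_lt_iff₀ hN0]
      refine (h N hN1).trans_lt ?_
      rwa [div_lt_iff₀ hc] at hN
    nlinarith

/-- As `a` solves the recurrence exactly, the defect of the tapered sequence comes only from the
slope `1 / N` of the taper, multiplied by `‖z‖`. Hence the taper estimate is applied with `c = ε /
‖z‖`. -/
theorem exists_almost_null_coefficients {z : ℂ} (hz : z ≠ 0) {a v : ℤ → ℂ}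
    (hrec : ∀ n, z * a (n + 1) = v n * a n) (ha : ∀ n, ‖a n‖ ≤ 1) (ha0 : ‖a 0‖ = 1)
    {ε : ℝ} (hε : 0 < ε) :
    ∃ (N : ℕ) (α : ℕ → ℂ), α 0 = 0 ∧ α (2 * N) = 0 ∧
      ∑ i ∈ Finset.range (2 * N), ‖z * α (i + 1) - v ((i : ℤ) - N) * α i‖ <
        ε * ∑ i ∈ Finset.range (2 * N), ‖α i‖ := by
  have hz' : 0 < ‖z‖ := norm_pos_iff.2 hz
  obtain ⟨N, hN, hlt⟩ := exists_sum_lt_mul_sum_taper (r := fun n => ‖a n‖)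
    (fun n => norm_nonneg _) ha ha0 (div_pos hε hz')
  have hN' : (0 : ℝ) < N := by exact_mod_cast hN
  let b : ℤ → ℝ := fun n => 1 - |(n : ℝ)| / N
  let α : ℕ → ℂ := fun i => (b ((i : ℤ) - N) : ℂ) * a ((i : ℤ) - N)
  have hαN : α (2 * N) = 0 := by
    have : b (((2 * N : ℕ) : ℤ) - N) = 0 := by
      simp only [b]
      push_cast
      rw [show (2 * (N : ℝ) - N) = N by ring, abs_of_pos hN', div_self hN'.ne', sub_self]
    simp only [α, this]
    simp
  have hα0 : α 0 = 0 := by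
    have : b (((0 : ℕ) : ℤ) - N) = 0 := by
      simp only [b]
      push_cast
      rw [zero_sub, abs_neg, abs_of_pos hN', div_self hN'.ne', sub_self]
    simp only [α, this]
    simp
  refine ⟨N, α, hα0, hαN, ?_⟩
  have hright : ∑ n ∈ Finset.Icc (-(N : ℤ)) N, b n * ‖a n‖ =
      ∑ i ∈ Finset.range (2 * N), ‖α i‖ := by
    have hs := Finset.sum_range_succ (fun i => ‖α i‖) (2 * N)
    rw [hαN, norm_zero, add_zero] at hs
    rw [← hs, ← sum_range_eq_sum_Icc_neg]
    refine Finset.sum_congr rfl fun i hi => ?_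
    rw [Finset.mem_range] at hi
    simp only [α, norm_mul, Complex.norm_real, Real.norm_eq_abs]
    rw [abs_of_nonneg]
    simp only [b]
    rw [sub_nonneg, div_le_one hN', abs_le]
    push_cast
    have : (i : ℝ) ≤ 2 * N := by exact_mod_cast Nat.lt_succ_iff.1 hi
    constructor
    · linarith [(Nat.cast_nonneg i : (0 : ℝ) ≤ i)]
    · linarith
  have hleft : ∑ i ∈ Finset.range (2 * N), ‖z * α (i + 1) - v ((i : ℤ) - N) * α i‖ ≤
      ‖z‖ * (1 / N * ∑ n ∈ Finset.Icc (-(N : ℤ)) N, ‖a n‖) := by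
    have h1 : ∀ i : ℕ, ‖z * α (i + 1) - v ((i : ℤ) - N) * α i‖ ≤
        ‖z‖ * (1 / N) * ‖a (((i + 1 : ℕ) : ℤ) - N)‖ := by
      intro i
      have hi : (((i + 1 : ℕ) : ℤ) - N) = ((i : ℤ) - N) + 1 := by push_cast; ring
      have heq : z * α (i + 1) - v ((i : ℤ) - N) * α i =
          ((b ((i : ℤ) - N + 1) - b ((i : ℤ) - N) : ℝ) : ℂ) * (z * a ((i : ℤ) - N + 1)) := by
        simp only [α]
        rw [hi, mul_left_comm (v _), ← hrec]
        push_cast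
        ring
      rw [heq, hi, norm_mul, norm_mul, Complex.norm_real, Real.norm_eq_abs]
      have hbd : |b ((i : ℤ) - N + 1) - b ((i : ℤ) - N)| ≤ 1 / N := by
        have : b ((i : ℤ) - N + 1) - b ((i : ℤ) - N) =
            (|(((i : ℤ) - N : ℤ) : ℝ)| - |(((i : ℤ) - N + 1 : ℤ) : ℝ)|) / N := by
          simp only [b]
          ring
        rw [this, abs_div, abs_of_pos hN']
        gcongr
        refine (abs_abs_sub_abs_le_abs_sub _ _).trans ?_
        push_cast
        rw [show ((i : ℝ) - N - (i - N + 1)) = -1 by ring]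
        simp
      calc _ ≤ 1 / (N : ℝ) * (‖z‖ * ‖a ((i : ℤ) - N + 1)‖) := by gcongr
        _ = _ := by ring
    refine (Finset.sum_le_sum fun i _ => h1 i).trans ?_
    rw [← Finset.mul_sum, mul_assoc]
    gcongr
    rw [← sum_range_eq_sum_Icc_neg, Finset.sum_range_succ']
    exact le_add_of_nonneg_right (norm_nonneg _)
  refine hleft.trans_lt ?_
  rw [← hright]
  calc _ < ‖z‖ * (ε / ‖z‖ * ∑ n ∈ Finset.Icc (-(N : ℤ)) N, b n * ‖a n‖) := by gcongr
    _ = _ := by field_simp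

end Taper

/-! ### Almost null functionals supported on the given orbit. -/

section Cocycle

variable {B : Type*} [NormedCommRing B] [NormedAlgebra ℂ B]

theorem weightCocycle_succ (w : B) (U : B →A[ℂ] B) (n : ℕ) (t : characterSpace ℂ B) :
    weightCocycle w U (n + 1) t = weightCocycle w U n t * ((spectrumMap U)^[n] t) w :=
  Finset.prod_range_succ _ _

theorem weightCocycle_succ' (w : B) (U : B →A[ℂ] B) (n : ℕ) (t : characterSpace ℂ B) :
    weightCocycle w U (n + 1) t = t w * weightCocycle w U n (spectrumMap U t) := by
  simp only [weightCocycle, Finset.prod_range_succ', Function.iterate_succ_apply,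
    Function.iterate_zero, id_eq]
  exact mul_comm _ _

theorem iterate_spectrumMap_orbit {U : B →A[ℂ] B} {t : ℤ → characterSpace ℂ B}
    (horbit : ∀ n : ℤ, spectrumMap U (t n) = t (n + 1)) (i : ℕ) (n : ℤ) :
    (spectrumMap U)^[i] (t n) = t (n + i) := by
  induction i with
  | zero => simp
  | succ i ih =>
    rw [Function.iterate_succ_apply', ih, horbit]
    congr 1
    push_cast
    ring

/-- The normalized solution, along a full orbit, of the equation for an eigenvector of the
adjoint of the weighted endomorphism. -/
theorem exists_orbit_weights {w : B} {U : B →A[ℂ] B} {z : ℂ} (hz : z ≠ 0)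
    {t : ℤ → characterSpace ℂ B} (horbit : ∀ n : ℤ, spectrumMap U (t n) = t (n + 1))
    (hforward : ∀ n : ℕ, 1 ≤ n → ‖weightCocycle w U n (t 0)‖ ≤ ‖z‖ ^ n)
    (hbackward : ∀ n : ℕ, 1 ≤ n → ‖z‖ ^ n ≤ ‖weightCocycle w U n (t (-(n : ℤ)))‖) :
    ∃ a : ℤ → ℂ, (∀ n, z * a (n + 1) = t n w * a n) ∧ (∀ n, ‖a n‖ ≤ 1) ∧ ‖a 0‖ = 1 := by
  have hz' : 0 < ‖z‖ := norm_pos_iff.2 hz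
  have hback : ∀ n : ℕ, weightCocycle w U n (t (-(n : ℤ))) ≠ 0 := fun n => by
    rcases Nat.eq_zero_or_pos n with rfl | hn
    · simp [weightCocycle]
    · exact norm_pos_iff.1 ((pow_pos hz' n).trans_le (hbackward n hn))
  -- Iterating the recurrence from `a 0 = 1` in both directions; the two growth hypotheses are then
  -- exactly `‖a n‖ ≤ 1`.
  let a : ℤ → ℂ := fun n => match n with
    | Int.ofNat k => weightCocycle w U k (t 0) / z ^ k
    | Int.negSucc k => z ^ (k + 1) / weightCocycle w U (k + 1) (t (-((k + 1 : ℕ) : ℤ)))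
  refine ⟨a, fun n => ?_, fun n => ?_, ?_⟩
  · rcases n with k | k
    · change z * (weightCocycle w U (k + 1) (t 0) / z ^ (k + 1)) =
        t (k : ℤ) w * (weightCocycle w U k (t 0) / z ^ k)
      rw [weightCocycle_succ, iterate_spectrumMap_orbit horbit, zero_add]
      field_simp
      ring
    · have hstep : weightCocycle w U (k + 1) (t (-((k + 1 : ℕ) : ℤ))) =
          t (-((k + 1 : ℕ) : ℤ)) w * weightCocycle w U k (t (-(k : ℤ))) := by
        rw [weightCocycle_succ', horbit]
        congr 3
        push_cast
        ring
      have hne := hback (k + 1)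
      have hne' := hback k
      have hval : a (Int.negSucc k + 1) = z ^ k / weightCocycle w U k (t (-(k : ℤ))) := by
        rcases k with _ | k
        · change weightCocycle w U 0 (t 0) / z ^ 0 = _
          simp [weightCocycle]
        · rfl
      rw [hval]
      change z * _ = t (-((k + 1 : ℕ) : ℤ)) w *
        (z ^ (k + 1) / weightCocycle w U (k + 1) (t (-((k + 1 : ℕ) : ℤ))))
      rw [hstep] at hne ⊢
      have hw := left_ne_zero_of_mul hne
      field_simp
      ring
  · rcases n with k | k
    · change ‖weightCocycle w U k (t 0) / z ^ k‖ ≤ 1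
      rw [norm_div, norm_pow, div_le_one (pow_pos hz' k)]
      rcases Nat.eq_zero_or_pos k with rfl | hk
      · simp [weightCocycle]
      · exact hforward k hk
    · change ‖z ^ (k + 1) / weightCocycle w U (k + 1) (t (-((k + 1 : ℕ) : ℤ)))‖ ≤ 1
      rw [norm_div, norm_pow, div_le_one (norm_pos_iff.2 (hback _))]
      exact hbackward (k + 1) (by omega)
  · change ‖weightCocycle w U 0 (t 0) / z ^ 0‖ = 1
    simp [weightCocycle]

theorem exists_orbit_almost_null_coefficients {w : B} {U : B →A[ℂ] B} {z : ℂ}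
    {t : ℤ → characterSpace ℂ B} (horbit : ∀ n : ℤ, spectrumMap U (t n) = t (n + 1))
    (hforward : ∀ n : ℕ, 1 ≤ n → ‖weightCocycle w U n (t 0)‖ ≤ ‖z‖ ^ n)
    (hbackward : ∀ n : ℕ, 1 ≤ n → ‖z‖ ^ n ≤ ‖weightCocycle w U n (t (-(n : ℤ)))‖)
    {ε : ℝ} (hε : 0 < ε) :
    ∃ (n : ℤ) (m : ℕ) (α : ℕ → ℂ), α 0 = 0 ∧ α m = 0 ∧
      ∑ i ∈ Finset.range m, ‖z * α (i + 1) - ((spectrumMap U)^[i] (t n)) w * α i‖ <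
        ε * ∑ i ∈ Finset.range m, ‖α i‖ := by
  rcases eq_or_ne z 0 with rfl | hz
  -- For `z = 0` the adjoint kills the evaluation at `t 0`. The segment starts one step earlier, at
  -- `t (-1)`, so that the coefficients vanish at both ends.
  · have h0 : t 0 w = 0 := by simpa [weightCocycle] using hforward 1 le_rfl
    refine ⟨-1, 2, fun i => if i = 1 then 1 else 0, by simp, by simp, ?_⟩
    simp [Finset.sum_range_succ, horbit, h0, hε]
  · obtain ⟨a, hrec, ha, ha0⟩ := exists_orbit_weights hz horbit hforward hbackward
    obtain ⟨N, α, h0, hN, hlt⟩ := exists_almost_null_coefficients hz hrec ha ha0 hε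
    refine ⟨-N, 2 * N, α, h0, hN, ?_⟩
    simp only [iterate_spectrumMap_orbit horbit]
    simpa only [neg_add_eq_sub] using hlt

end Cocycle

/-! ### Consequences of closed range and of finite codimension. -/

section Range

variable {X : Type*} [NormedAddCommGroup X] [NormedSpace ℂ X]

theorem exists_norm_preimage_le_of_isClosed_range [CompleteSpace X] (S : X →L[ℂ] X) (hS : IsClosed (range S)) :
    ∃ C > 0, ∀ f ∈ LinearMap.range (S : X →ₗ[ℂ] X), ∃ g, S g = f ∧ ‖g‖ ≤ C * ‖f‖ := by
  let R : Submodule ℂ X := LinearMap.range (S : X →ₗ[ℂ] X)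
  have hR : IsClosed (R : Set X) := hS
  have : CompleteSpace R := hR.completeSpace_coe
  let S' : X →L[ℂ] R := S.codRestrict R fun x => ⟨x, rfl⟩
  have hsurj : Function.Surjective S' := by
    rintro ⟨_, x, rfl⟩
    exact ⟨x, rfl⟩
  obtain ⟨C, hC, h⟩ := S'.exists_preimage_norm_le hsurj
  refine ⟨C, hC, fun f hf => ?_⟩
  obtain ⟨g, hg, hgn⟩ := h ⟨f, hf⟩
  exact ⟨g, congrArg Subtype.val hg, hgn⟩

/-- One vector more than the codimension forces a linear relation modulo `R`; divide it by its
coefficient of largest modulus. -/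
theorem exists_normalized_combination_mem {R : Submodule ℂ X} [FiniteDimensional ℂ (X ⧸ R)]
    (F : Fin (Module.finrank ℂ (X ⧸ R) + 1) → X) :
    ∃ (c : Fin (Module.finrank ℂ (X ⧸ R) + 1) → ℂ) (j₀ : _),
      c j₀ = 1 ∧ (∀ j, ‖c j‖ ≤ 1) ∧ ∑ j, c j • F j ∈ R := by
  have hdep : ¬ LinearIndependent ℂ fun j => R.mkQ (F j) := fun h => by
    have := h.fintype_card_le_finrank
    simp at this
  obtain ⟨c, hc, j₁, hj₁⟩ := Fintype.not_linearIndependent_iff.1 hdep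
  obtain ⟨j₀, hj₀⟩ := Finite.exists_max fun j => ‖c j‖
  have hpos : 0 < ‖c j₀‖ := (norm_pos_iff.2 hj₁).trans_le (hj₀ j₁)
  refine ⟨fun j => (c j₀)⁻¹ * c j, j₀, inv_mul_cancel₀ (norm_pos_iff.1 hpos), fun j => ?_, ?_⟩
  · rw [norm_mul, norm_inv, inv_mul_le_one₀ hpos]
    exact hj₀ j
  · have hmem : ∑ j, c j • F j ∈ R := by
      rw [← Submodule.Quotient.mk_eq_zero, ← Submodule.mkQ_apply, map_sum]
      simpa using hc
    have := R.smul_mem (c j₀)⁻¹ hmem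
    rwa [Finset.smul_sum, Finset.sum_congr rfl fun j _ => smul_smul (c j₀)⁻¹ (c j) (F j)] at this

end Range

/-- Meant for combinations of peaking elements at a point of one of the disjoint sets, where all
terms but one are small. -/
theorem norm_sum_mul_sub_le {ι : Type*} [Fintype ι] {d x : ι → ℂ} (hd : ∀ p, ‖d p‖ ≤ 1)
    (p₀ : ι) {δ : ℝ} (hδ : 0 ≤ δ) (hx : ∀ p ≠ p₀, ‖x p‖ ≤ δ) :
    ‖∑ p, d p * x p - d p₀ * x p₀‖ ≤ Fintype.card ι * δ := by
  classical
  rw [← Finset.add_sum_erase _ _ (Finset.mem_univ p₀), add_sub_cancel_left]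
  calc _ ≤ ∑ p ∈ Finset.univ.erase p₀, ‖d p * x p‖ := norm_sum_le _ _
    _ ≤ ∑ _p ∈ Finset.univ.erase p₀, δ := Finset.sum_le_sum fun p hp => by
        rw [norm_mul]
        exact (mul_le_of_le_one_left (norm_nonneg _) (hd p)).trans (hx p (Finset.ne_of_mem_erase hp))
    _ ≤ ∑ _p : ι, δ := Finset.sum_le_sum_of_subset_of_nonneg (Finset.subset_univ _) fun _ _ _ => hδ
    _ = _ := by simp

/-! ### The contradiction between the closed range bound and the almost null functionals. -/

section Weighted

variable {B : Type*} [NormedCommRing B] [NormedAlgebra ℂ B]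

theorem continuous_spectrumMap (U : B →A[ℂ] B) : Continuous (spectrumMap U) :=
  Continuous.subtype_mk (WeakDual.continuous_of_continuous_eval fun f =>
    continuous_character_apply (U f)) _

/-- Summation by parts for the adjoint action on a functional supported by an orbit segment. -/
theorem sum_orbit_apply_sub_weightedEndomorphism (w : B) (U : B →A[ℂ] B) (z : ℂ) (g : B)
    (s : characterSpace ℂ B) {m : ℕ} {α : ℕ → ℂ} (h0 : α 0 = 0) (hm : α m = 0) :
    ∑ i ∈ Finset.range m, α i *
        ((spectrumMap U)^[i] s) ((z • ContinuousLinearMap.id ℂ B - weightedEndomorphism w U) g) =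
      ∑ i ∈ Finset.range m, (z * α (i + 1) - ((spectrumMap U)^[i] s) w * α i) *
        ((spectrumMap U)^[i + 1] s) g := by
  have happ : ∀ q : characterSpace ℂ B,
      q ((z • ContinuousLinearMap.id ℂ B - weightedEndomorphism w U) g) =
        z * q g - q w * spectrumMap U q g := fun q => by
    rw [spectrumMap_apply, ← map_mul, ← weightedEndomorphism_apply, ← smul_eq_mul, ← map_smul,
      ← map_sub]
    rfl
  have hshift : ∑ i ∈ Finset.range m, α i * ((spectrumMap U)^[i] s) g =
      ∑ i ∈ Finset.range m, α (i + 1) * ((spectrumMap U)^[i + 1] s) g := by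
    have h1 := Finset.sum_range_succ (fun i => α i * ((spectrumMap U)^[i] s) g) m
    rw [Finset.sum_range_succ', h0, hm] at h1
    simpa using h1.symm
  have h2 := congrArg (fun c => z * c) hshift
  simp only [Finset.mul_sum] at h2
  simp only [happ, ← Function.iterate_succ_apply' (spectrumMap U)]
  rw [← sub_eq_zero, ← Finset.sum_sub_distrib]
  rw [← sub_eq_zero, ← Finset.sum_sub_distrib] at h2
  rw [← h2]
  exact Finset.sum_congr rfl fun i _ => by ring

theorem norm_sum_orbit_sub_weightedEndomorphism_le (hle : ∀ (s : characterSpace ℂ B) (f : B),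
      ‖s f‖ ≤ ‖f‖) (w : B) (U : B →A[ℂ] B) (z : ℂ) (g : B)
    (s : characterSpace ℂ B) {m : ℕ} {α : ℕ → ℂ} (h0 : α 0 = 0) (hm : α m = 0) :
    ‖∑ i ∈ Finset.range m, α i *
        ((spectrumMap U)^[i] s) ((z • ContinuousLinearMap.id ℂ B - weightedEndomorphism w U) g)‖ ≤
      (∑ i ∈ Finset.range m, ‖z * α (i + 1) - ((spectrumMap U)^[i] s) w * α i‖) * ‖g‖ := by
  rw [sum_orbit_apply_sub_weightedEndomorphism w U z g s h0 hm, Finset.sum_mul]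
  refine (norm_sum_le _ _).trans (Finset.sum_le_sum fun i _ => ?_)
  rw [norm_mul]
  gcongr
  exact hle _ _

/-- Of the uniform algebra structure, only completeness and the isometry of the Gelfand transform
(`hle`, `hnorm`) enter. -/
theorem mem_lowerSemiFredholmSpectrum_of_orbit [CompleteSpace B]
    (hle : ∀ (s : characterSpace ℂ B) (f : B), ‖s f‖ ≤ ‖f‖)
    (hnorm : ∀ f : B, ∃ s : characterSpace ℂ B, ‖f‖ ≤ ‖s f‖)
    (U : B →A[ℂ] B) (w : B)
    (hmaps : MapsTo (spectrumMap U) (shilovBoundary B) (shilovBoundary B))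
    (hopen : IsOpenMap hmaps.restrict)
    (hperfect : ∀ x : shilovBoundary B, ¬ IsOpen ({x} : Set (shilovBoundary B)))
    (hmeagre : IsMeagre (Function.periodicPts hmaps.restrict))
    (z : ℂ) (t : ℤ → characterSpace ℂ B)
    (ht : ∀ n : ℤ, t n ∈ shilovBoundary B)
    (horbit : ∀ n : ℤ, spectrumMap U (t n) = t (n + 1))
    (hforward : ∀ n : ℕ, 1 ≤ n → ‖weightCocycle w U n (t 0)‖ ≤ ‖z‖ ^ n)
    (hbackward : ∀ n : ℕ, 1 ≤ n → ‖z‖ ^ n ≤ ‖weightCocycle w U n (t (-(n : ℤ)))‖) :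
    z ∈ lowerSemiFredholmSpectrum (weightedEndomorphism w U) := by
  intro hS
  have : Nonempty (characterSpace ℂ B) := ⟨t 0⟩
  set S := z • ContinuousLinearMap.id ℂ B - weightedEndomorphism w U with hSdef
  obtain ⟨hclosed, hfin⟩ := hS
  obtain ⟨C, hC, hpre⟩ := exists_norm_preimage_le_of_isClosed_range S hclosed
  -- With `‖g‖ ≤ 2C` below, this `ε` gives the upper bound `L / 4`, against the lower bound `L / 2`.
  obtain ⟨n, m, α, hα0, hαm, hα⟩ := exists_orbit_almost_null_coefficients horbit hforward
    hbackward (ε := 1 / (8 * C)) (by positivity)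
  set L := ∑ i ∈ Finset.range m, ‖α i‖ with hL
  set Φ := hmaps.restrict with hΦ
  have hΦval : ∀ (i : ℕ) (q : shilovBoundary B),
      ((Φ^[i] q : shilovBoundary B) : characterSpace ℂ B) = (spectrumMap U)^[i] q := by
    intro i
    induction i with
    | zero => exact fun q => rfl
    | succ i ih => exact fun q => ih (Φ q)
  have hΦcont : Continuous Φ := (continuous_spectrumMap U).restrict hmaps
  have hLpos : 0 < L := by
    have : 0 < 1 / (8 * C) * L := lt_of_le_of_lt (Finset.sum_nonneg fun _ _ => norm_nonneg _) hα
    exact pos_of_mul_pos_right this (by positivity)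
  let V : Set (shilovBoundary B) := {q | ∑ i ∈ Finset.range m,
    ‖z * α (i + 1) - ((spectrumMap U)^[i] q) w * α i‖ < 1 / (8 * C) * L}
  have hV : IsOpen V := by
    refine isOpen_lt (continuous_finsetSum _ fun i _ => ?_) continuous_const
    exact (continuous_const.sub (((continuous_character_apply w).comp
      (((continuous_spectrumMap U).iterate i).comp continuous_subtype_val)).mul
        continuous_const)).norm
  have hVne : V.Nonempty := ⟨⟨t n, ht n⟩, hα⟩
  set k := Module.finrank ℂ (B ⧸ LinearMap.range (S : B →ₗ[ℂ] B)) + 1 with hk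
  -- All cross terms together with the error at one peak then amount to at most `1/2`.
  set δ : ℝ := 1 / (2 * (Fintype.card (Fin k × Fin m) + 1)) with hδdef
  have hδ : 0 < δ := by positivity
  have hδ' : Fintype.card (Fin k × Fin m) * δ + δ = 1 / 2 := by
    rw [hδdef]
    field_simp
  obtain ⟨s, f, W, hsV, hW, hsW, hf1, hfW, hfs⟩ :=
    exists_orbits_forall_peak hΦcont hopen hperfect hmeagre hV hVne k m hδ
  -- Phases aligning the terms, so that `α i * θ i = ‖α i‖`; division by zero gives `θ i = 0` when
  -- `α i = 0`, which is harmless.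
  let θ : ℕ → ℂ := fun i => ‖α i‖ / α i
  have hθ : ∀ i, ‖θ i‖ ≤ 1 := fun i => by
    simp only [θ, norm_div, Complex.norm_real, norm_norm]
    exact div_self_le_one _
  have hαθ : ∀ i, α i * θ i = ‖α i‖ := fun i => by
    by_cases h : α i = 0
    · simp [h]
    · exact mul_div_cancel₀ _ h
  obtain ⟨c, j₀, hcj₀, hc, hmem⟩ := exists_normalized_combination_mem
    (R := LinearMap.range (S : B →ₗ[ℂ] B)) fun j => ∑ i : Fin m, θ i • f j i
  let d : Fin k × Fin m → ℂ := fun p => c p.1 * θ p.2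
  have hd : ∀ p, ‖d p‖ ≤ 1 := fun p => by
    rw [norm_mul]
    exact mul_le_one₀ (hc _) (norm_nonneg _) (hθ _)
  obtain ⟨h, hh⟩ : ∃ h : B, h = ∑ j, c j • ∑ i : Fin m, θ i • f j i := ⟨_, rfl⟩
  rw [← hh] at hmem
  have hval : ∀ q : characterSpace ℂ B, q h = ∑ p, d p * q (f p.1 p.2) := fun q => by
    rw [hh, Fintype.sum_prod_type]
    simp only [map_sum, map_smul, smul_eq_mul, Finset.mul_sum, d, mul_assoc]
    rfl
  have hsmall : ∀ (q : shilovBoundary B) (p₀ : Fin k × Fin m), q ∈ W p₀ → ∀ p ≠ p₀,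
      ‖(q : characterSpace ℂ B) (f p.1 p.2)‖ ≤ δ := fun q p₀ hq p hp =>
    (hfW p.1 p.2 q fun hq' => (hW hp).le_bot ⟨hq', hq⟩).le
  -- The norm is attained on the Shilov boundary, where a point lies in at most one `W p`: one term
  -- of modulus at most 1, plus small ones. The bound does not depend on `m`.
  have hhnorm : ‖h‖ ≤ 2 := by
    obtain ⟨s', hs'⟩ := hnorm h
    obtain ⟨q, hq, hmax⟩ := (minimal_isClosedBoundary_shilovBoundary B).1.2 h
    refine (hs'.trans (hmax s')).trans ?_
    by_cases hex : ∃ p₀, (⟨q, hq⟩ : shilovBoundary B) ∈ W p₀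
    · obtain ⟨p₀, hp₀⟩ := hex
      have h1 := norm_sum_mul_sub_le hd p₀ hδ.le (hsmall ⟨q, hq⟩ p₀ hp₀)
      rw [← hval] at h1
      have h2 : ‖d p₀ * q (f p₀.1 p₀.2)‖ ≤ 1 := by
        rw [norm_mul]
        exact mul_le_one₀ (hd _) (norm_nonneg _) (hf1 _ _ _)
      have h3 := norm_le_norm_add_norm_sub (d p₀ * q (f p₀.1 p₀.2)) (q h)
      rw [norm_sub_rev] at h3
      linarith
    · push Not at hex
      rw [hval]
      have : ‖∑ p, d p * q (f p.1 p.2)‖ ≤ ∑ _p : Fin k × Fin m, δ := by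
        refine (norm_sum_le _ _).trans (Finset.sum_le_sum fun p _ => ?_)
        rw [norm_mul]
        exact (mul_le_of_le_one_left (norm_nonneg _) (hd p)).trans
          (hfW p.1 p.2 ⟨q, hq⟩ (hex p)).le
      rw [Finset.sum_const, Finset.card_univ, nsmul_eq_mul] at this
      linarith
  have heval : ∀ i < m, ‖((spectrumMap U)^[i] (s j₀)) h - θ i‖ ≤ 1 / 2 := fun i hi => by
    have h1 := norm_sum_mul_sub_le hd (j₀, ⟨i, hi⟩) hδ.le (hsmall _ _ (hsW j₀ ⟨i, hi⟩))
    rw [← hval] at h1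
    have h2 := hfs j₀ ⟨i, hi⟩
    simp only [hΦval, d, hcj₀, one_mul] at h1 h2
    have h3 : ‖θ i * (((spectrumMap U)^[i] (s j₀)) (f j₀ ⟨i, hi⟩) - 1)‖ ≤ δ := by
      rw [norm_mul]
      exact (mul_le_of_le_one_left (norm_nonneg _) (hθ i)).trans h2.le
    rw [← hδ']
    refine le_trans (le_of_eq ?_) ((norm_add_le _ _).trans (add_le_add h1 h3))
    congr 1
    ring
  -- Along the segment of `s j₀`, whose coefficient is 1, `h` is within `1/2` of `θ i`, so the
  -- pairing is within `L / 2` of `∑ α i * θ i = L`.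
  have hlower : L / 2 ≤ ‖∑ i ∈ Finset.range m, α i * ((spectrumMap U)^[i] (s j₀)) h‖ := by
    have hLc : ‖(L : ℂ)‖ = L := by
      rw [Complex.norm_real, Real.norm_eq_abs, abs_of_pos hLpos]
    have hsum : ‖(L : ℂ) - ∑ i ∈ Finset.range m, α i * ((spectrumMap U)^[i] (s j₀)) h‖ ≤
        L * (1 / 2) := by
      rw [norm_sub_rev, hL, Complex.ofReal_sum, ← Finset.sum_sub_distrib, Finset.sum_mul]
      refine (norm_sum_le _ _).trans (Finset.sum_le_sum fun i hi => ?_)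
      rw [← hαθ, ← mul_sub, norm_mul]
      gcongr
      exact heval i (Finset.mem_range.1 hi)
    have := norm_sub_norm_le (L : ℂ)
      (∑ i ∈ Finset.range m, α i * ((spectrumMap U)^[i] (s j₀)) h)
    linarith
  obtain ⟨g, hg, hgn⟩ := hpre h hmem
  have hupper := norm_sum_orbit_sub_weightedEndomorphism_le hle w U z g (s j₀) hα0 hαm
  rw [← hSdef, hg] at hupper
  have hE := hsV j₀
  have hgle : ‖g‖ ≤ 2 * C := hgn.trans (by nlinarith)
  have hfinal : (∑ i ∈ Finset.range m,
      ‖z * α (i + 1) - ((spectrumMap U)^[i] (s j₀)) w * α i‖) * ‖g‖ ≤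
        1 / (8 * C) * L * (2 * C) :=
    mul_le_mul hE.le hgle (norm_nonneg _) (by positivity)
  have : 1 / (8 * C) * L * (2 * C) = L / 4 := by
    field_simp
    norm_num
  linarith

end Weighted

/-! ### The Gelfand transform of a closed subalgebra of `C(K, ℂ)` preserves the norm. -/

section UniformAlgebra

variable {K : Type*} [TopologicalSpace K] [CompactSpace K]

/-- Evaluation at a point of the underlying compact space, as a character. -/
noncomputable def evalCharacter (A : Subalgebra ℂ C(K, ℂ)) (x : K) : characterSpace ℂ A :=
  ⟨(ContinuousMap.evalCLM ℂ x).comp A.toSubmodule.subtypeL, by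
    rw [CharacterSpace.eq_set_map_one_map_mul]
    exact ⟨rfl, fun _ _ => rfl⟩⟩

theorem exists_norm_le_norm_character_apply (A : Subalgebra ℂ C(K, ℂ))
    [Nonempty (characterSpace ℂ A)] (f : A) : ∃ s : characterSpace ℂ A, ‖f‖ ≤ ‖s f‖ := by
  rcases isEmpty_or_nonempty K with hK | hK
  · have : f = 0 := Subtype.ext (ContinuousMap.ext fun x => hK.elim x)
    exact ⟨Classical.arbitrary _, by simp [this]⟩
  · obtain ⟨x, -, hx⟩ := isCompact_univ.exists_isMaxOn univ_nonempty
      (f : C(K, ℂ)).continuous.norm.continuousOn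
    refine ⟨evalCharacter A x, ?_⟩
    exact (ContinuousMap.norm_le _ (norm_nonneg _)).2 fun y => hx (mem_univ y)

theorem norm_character_apply_le_of_subalgebra (A : Subalgebra ℂ C(K, ℂ)) [CompleteSpace A]
    (s : characterSpace ℂ A) (f : A) : ‖s f‖ ≤ ‖f‖ := by
  have h1 : ‖(1 : A)‖ ≤ 1 := (ContinuousMap.norm_le _ zero_le_one).2 fun x => by simp
  refine ((CharacterSpace.toCLM s).le_opNorm f).trans ?_
  exact mul_le_of_le_one_left (norm_nonneg _) ((CharacterSpace.norm_le_norm_one s).trans h1)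

end UniformAlgebra

theorem proposition2 {K : Type*} [TopologicalSpace K] [CompactSpace K] [T2Space K]
    (A : Subalgebra ℂ C(K, ℂ)) (hA : IsUniformAlgebra A)
    (U : A →A[ℂ] A) (hU : Isometry U) (w : A)
    (hmaps : MapsTo (spectrumMap U) (shilovBoundary A) (shilovBoundary A))
    (hopen : IsOpenMap hmaps.restrict)
    (hperfect : ∀ x : shilovBoundary A, ¬ IsOpen ({x} : Set (shilovBoundary A)))
    (hmeagre : IsMeagre (Function.periodicPts hmaps.restrict))
    (z : ℂ) (t : ℤ → characterSpace ℂ A)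
    (ht : ∀ n : ℤ, t n ∈ shilovBoundary A)
    (horbit : ∀ n : ℤ, spectrumMap U (t n) = t (n + 1))
    (hforward : ∀ n : ℕ, 1 ≤ n → ‖weightCocycle w U n (t 0)‖ ≤ ‖z‖ ^ n)
    (hbackward : ∀ n : ℕ, 1 ≤ n → ‖z‖ ^ n ≤ ‖weightCocycle w U n (t (-(n : ℤ)))‖) :
    z ∈ lowerSemiFredholmSpectrum (weightedEndomorphism w U) := by
  have : CompleteSpace A := hA.isClosed.completeSpace_coe
  have : Nonempty (characterSpace ℂ A) := ⟨t 0⟩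
  exact mem_lowerSemiFredholmSpectrum_of_orbit (norm_character_apply_le_of_subalgebra A)
    (exists_norm_le_norm_character_apply A) U w hmaps hopen hperfect hmeagre z t ht horbit
    hforward hbackward
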